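/- **Setting.** Let $\mathcal C$ be a finite combinatorial two-complex with bulk vertices $v$, internal edges $e$, faces $f$, and boundary graph with nodes $n$ and oriented links $l$ (source $s_l$, target $t_l$). Internal edges are oriented and run between bulk vertices or nodes, with at least one endpoint in the bulk; every bulk vertex bounds at least one internal edge; every node bounds exactly one internal edge; the boundary $\partial f$ of each face is a nonempty closed walk of internal edges and links, with signs $\epsilon_{ef}=\pm1$ recording the orientation; every link occurs exactly once in the boundaries of the faces. Fix $\gamma>0$ and a Haar measure on $SL(2,\mathbb C)$; $SU(2)$ carries its normalized Haar measure. $SL(2,\mathbb C)$ acts on the hyperboloid $\mathbb H^3$ of future-directed unit timelike vectors by Lorentz transformations: with $X=x^0+\vec x\cdot\vec\sigma$, $\Lambda x$ is the vector of $\Lambda X\Lambda^\dagger$. For $x\in\mathbb H^3$ let $\Lambda_x\in SL(2,\mathbb C)$ be the pure boost sending $(1,0,0,0)$ to $x$, and for $h\in SU(2)$ put $h_x=\Lambda_x h\Lambda_x^{-1}$. Let $\chi^j$ be the spin-$j$ character of $SU(2)$, $d_j=2j+1$, and $\chi^{p,k}$ the character of the principal series representation $(p,k)$ of $SL(2,\mathbb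 C)$, that is $$\chi^{p,k}(g)=\frac{|z|^{2ip}(z/|z|)^{2k}+|z|^{-2ip}(z/|z|)^{-2k}}{|z-z^{-1}|^2},\qquad z,z^{-1}\text{ the eigenvalues of }g .$$ Given a frame vector $x_e\in\mathbb H^3$ for every internal edge and $g_l\in SL(2,\mathbb C)$ for every link, the amplitude is $$\tilde Z_{\mathcal C,x_e}(g_l)=\sum_{j_f\in\mathbb N/2}\ \prod_f d_{j_f}\int_{SL(2,\mathbb C)}dg_{ev}\int_{SU(2)}dh_{ef}\ \prod_f\chi^{\gamma j_f,j_f}\Big(\prod_{e\in\partial f}g_{ef}^{\epsilon_{ef}}\Big)\prod_{e\in\partial f}\chi^{j_f}(h_{ef}),$$ where $g_{ef}=g_{es_e}(h_{ef})_{x_e}g_{et_e}^{-1}$ for an internal edge $e$ with source $s_e$ and target $t_e$, and $g_{ef}=g_l$ for a link; the last product runs over the internal edges in $\partial f$ (there is one variable $h_{ef}$ for each occurrence of an internal edge $e$ in the boundary of a face $f$). There is one variable $g_{ev}$ for each end of an internal edge at a bulk vertex, except that at every bulk vertex one (arbitrarily chosen) end has $g_{ev}=1$ and is not integrated; at the boundary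 nodes $g_{en}=1$. The frame vector of the internal edge bounding the node $n$ is denoted $x_n$. **Theorem 3.** Let $\Lambda_n\in SL(2,\mathbb C)$ be given for every node $n$, and let $x_n\in\mathbb H^3$ and $g_l\in SL(2,\mathbb C)$ be arbitrary. Then $$\tilde Z_{\mathcal C,\Lambda_nx_n}(g_l)=\tilde Z_{\mathcal C,x_n}\big(\Lambda_{s_l}^{-1}\,g_l\,\Lambda_{t_l}\big),$$ for any choices of the frame vectors of the edges between two bulk vertices on the two sides. The equality holds separately for the contribution of every assignment of spins $j_f$, and the integrals (respectively the integrals and the sum over spins) on one side converge absolutely if and only if those on the other side do. -/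

import Mathlib

open MeasureTheory

namespace Spinfoam

/-- The group `SL(2,ℂ)`. -/
abbrev SL2C : Type := Matrix.SpecialLinearGroup (Fin 2) ℂ

/-- The group `SU(2)`. -/
abbrev SU2 : Type := Matrix.specialUnitaryGroup (Fin 2) ℂ

/-! ### Haar measures -/

noncomputable instance instMeasurableSpaceSL2C : MeasurableSpace SL2C := borel SL2C

instance instBorelSpaceSL2C : BorelSpace SL2C := ⟨rfl⟩

noncomputable instance instMeasurableSpaceSU2 : MeasurableSpace SU2 := borel SU2

instance instBorelSpaceSU2 : BorelSpace SU2 := ⟨rfl⟩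

instance instLocallyCompactSpaceSL2C : LocallyCompactSpace SL2C := by
  have : LocallyCompactSpace (Matrix (Fin 2) (Fin 2) ℂ) :=
    inferInstanceAs (LocallyCompactSpace (Fin 2 → Fin 2 → ℂ))
  exact Matrix.SpecialLinearGroup.isClosedEmbedding_val.locallyCompactSpace

instance instSecondCountableTopologySL2C : SecondCountableTopology SL2C := by
  have : SecondCountableTopology (Matrix (Fin 2) (Fin 2) ℂ) :=
    inferInstanceAs (SecondCountableTopology (Fin 2 → Fin 2 → ℂ))
  exact Matrix.SpecialLinearGroup.isClosedEmbedding_val.isEmbedding.secondCountableTopology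

instance instSecondCountableTopologySU2 : SecondCountableTopology SU2 := by
  have : SecondCountableTopology (Matrix (Fin 2) (Fin 2) ℂ) :=
    inferInstanceAs (SecondCountableTopology (Fin 2 → Fin 2 → ℂ))
  exact Topology.IsEmbedding.subtypeVal.secondCountableTopology

instance instIsTopologicalGroupSU2 : IsTopologicalGroup SU2 where
  continuous_mul := by
    refine Continuous.subtype_mk (f := fun p : SU2 × SU2 => p.1.1 * p.2.1) ?_ _
    exact (continuous_subtype_val.comp continuous_fst).mul
      (continuous_subtype_val.comp continuous_snd)
  continuous_inv := by
    refine Continuous.subtype_mk (f := fun p : SU2 => star p.1) ?_ _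
    exact continuous_subtype_val.star

instance instCompactSpaceSU2 : CompactSpace SU2 := by
  suffices hc : IsCompact ((Matrix.specialUnitaryGroup (Fin 2) ℂ : Submonoid _) :
      Set (Matrix (Fin 2) (Fin 2) ℂ)) from isCompact_iff_compactSpace.1 hc
  have hb : IsCompact (Set.pi Set.univ fun _ : Fin 2 => Set.pi Set.univ fun _ : Fin 2 =>
      Metric.closedBall (0 : ℂ) 1) :=
    isCompact_univ_pi fun _ => isCompact_univ_pi fun _ => isCompact_closedBall _ _
  refine IsCompact.of_isClosed_subset (X := Matrix (Fin 2) (Fin 2) ℂ) hb ?_ ?_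
  · have : ((Matrix.specialUnitaryGroup (Fin 2) ℂ : Submonoid _) :
        Set (Matrix (Fin 2) (Fin 2) ℂ)) = {A | A * star A = 1} ∩ {A | A.det = 1} := by
      ext A
      simp [Matrix.mem_specialUnitaryGroup_iff, Matrix.mem_unitaryGroup_iff]
    rw [this]
    exact (isClosed_eq (continuous_id.mul continuous_id.star) continuous_const).inter
      (isClosed_eq continuous_id.matrix_det continuous_const)
  · intro A hA i _ j _
    rw [mem_closedBall_zero_iff]
    exact entry_norm_bound_of_unitary (Matrix.mem_specialUnitaryGroup_iff.1 hA).1 i j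

/-- The normalized Haar measure of `SU(2)`. -/
noncomputable def haarSU2 : Measure SU2 := Measure.haarMeasure ⊤

/-! ### Characters -/

/-- One of the two eigenvalues of a unimodular `2 × 2` matrix with trace `t`; the other one is its
inverse. -/
noncomputable def eigenvalue (t : ℂ) : ℂ := (t + (t ^ 2 - 4) ^ (1 / 2 : ℂ)) / 2

theorem eigenvalue_mul (t : ℂ) : eigenvalue t * (t - eigenvalue t) = 1 := by
  have h : ((t ^ 2 - 4) ^ (1 / 2 : ℂ)) ^ 2 = t ^ 2 - 4 := by
    rw [one_div]
    exact Complex.cpow_nat_inv_pow _ two_ne_zero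
  unfold eigenvalue
  linear_combination (-1 / 4 : ℂ) * h

/-- The spin-`j` character `χ^j` of `SU(2)`, with `n = 2j`: the sum of the weights `z ^ (2m)`,
`m = -j, …, j`, where `z, z⁻¹` are the eigenvalues of `h`. -/
noncomputable def charSU2 (n : ℕ) (h : SU2) : ℂ :=
  ∑ i ∈ Finset.range (n + 1), eigenvalue (Matrix.trace h.1) ^ ((n : ℤ) - 2 * (i : ℤ))

/-- The character `χ^{p,k}` of the principal series representation `(p, k)` of `SL(2,ℂ)`, with
`n = 2k`. The representation acts on functions on `ℂ² ∖ 0` with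
`F (a z) = a ^ (ip + k - 1) * conj a ^ (ip - k - 1) * F z`, its character is the function
`(|z|^{2ip} (z/|z|)^{2k} + |z|^{-2ip} (z/|z|)^{-2k}) / |z - z⁻¹|²` of the eigenvalues `z, z⁻¹`
of `g`. It is defined where `z ≠ z⁻¹`, and the value `0` is assigned on the null set `z = z⁻¹`. -/
noncomputable def charSL2C (p : ℝ) (n : ℕ) (g : SL2C) : ℂ :=
  let z : ℂ := eigenvalue (Matrix.trace g.1)
  ((‖z‖ : ℂ) ^ (2 * Complex.I * p) * (z / ‖z‖) ^ n
      + (‖z‖ : ℂ) ^ (-(2 * Complex.I * p)) * ((z / ‖z‖)⁻¹) ^ n) / (‖z - z⁻¹‖ : ℂ) ^ 2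

/-! ### Frame vectors, boosts and embeddings of `SU(2)` -/

/-- The hyperboloid `ℍ³` of future-directed unit timelike vectors in Minkowski space. -/
abbrev Hyperboloid : Type :=
  {x : Fin 4 → ℝ // 0 < x 0 ∧ x 0 ^ 2 - x 1 ^ 2 - x 2 ^ 2 - x 3 ^ 2 = 1}

/-- The Hermitian matrix `x⁰ + x¹ σ₁ + x² σ₂ + x³ σ₃`. -/
noncomputable def pauli (x : Fin 4 → ℝ) : Matrix (Fin 2) (Fin 2) ℂ :=
  !![(x 0 : ℂ) + x 3, (x 1 : ℂ) - Complex.I * x 2; (x 1 : ℂ) + Complex.I * x 2, (x 0 : ℂ) - x 3]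

/-- The four-vector of a Hermitian matrix, inverse to `pauli`. -/
noncomputable def unpauli (Y : Matrix (Fin 2) (Fin 2) ℂ) : Fin 4 → ℝ :=
  ![((Y 0 0).re + (Y 1 1).re) / 2, (Y 1 0).re, (Y 1 0).im, ((Y 0 0).re - (Y 1 1).re) / 2]

theorem unpauli_pauli (x : Fin 4 → ℝ) : unpauli (pauli x) = x := by
  funext i
  fin_cases i <;> simp [unpauli, pauli]

theorem pauli_unpauli {Y : Matrix (Fin 2) (Fin 2) ℂ} (hY : Y.conjTranspose = Y) :
    pauli (unpauli Y) = Y := by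
  have h (i j) : star (Y j i) = Y i j := congrFun (congrFun hY i) j
  have h00 := h 0 0
  have h11 := h 1 1
  have h01 := h 0 1
  ext i j
  fin_cases i <;> fin_cases j <;> simp [unpauli, pauli, Complex.ext_iff] at * <;>
    constructor <;> linarith

/-- The pure boost `Λ_x ∈ SL(2,ℂ)` sending `(1,0,0,0)` to `x`: the positive Hermitian square root
of `pauli x`. -/
noncomputable def boost (x : Hyperboloid) : SL2C :=
  ⟨((Real.sqrt (2 * (1 + x.1 0)) : ℝ) : ℂ)⁻¹ • (1 + pauli x.1), by
    have h0 : 0 < 2 * (1 + x.1 0) := by have := x.2.1; linarith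
    have hs : ((Real.sqrt (2 * (1 + x.1 0)) : ℝ) : ℂ) ^ 2 = 2 * (1 + x.1 0) := by
      rw [← Complex.ofReal_pow, Real.sq_sqrt h0.le]; push_cast; ring
    have hne : (2 * (1 + x.1 0) : ℂ) ≠ 0 := by exact_mod_cast h0.ne'
    have h1 : (x.1 0 : ℂ) ^ 2 - x.1 1 ^ 2 - x.1 2 ^ 2 - x.1 3 ^ 2 = 1 := by
      exact_mod_cast x.2.2
    rw [Matrix.det_smul, Fintype.card_fin, inv_pow, hs, inv_mul_eq_one₀ hne]
    simp only [Matrix.det_fin_two, Matrix.add_apply, pauli]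
    simp
    linear_combination (-1 : ℂ) * h1 - (x.1 2 : ℂ) ^ 2 * Complex.I_sq⟩

theorem boost_conjTranspose (x : Hyperboloid) : (boost x).1.conjTranspose = (boost x).1 := by
  ext i j
  fin_cases i <;> fin_cases j <;> simp [boost, pauli, sub_eq_add_neg]

theorem boost_mul_boost (x : Hyperboloid) : (boost x).1 * (boost x).1 = pauli x.1 := by
  have h0 : 0 < 2 * (1 + x.1 0) := by have := x.2.1; linarith
  have hs : ((Real.sqrt (2 * (1 + x.1 0)) : ℝ) : ℂ) ^ 2 = 2 * (1 + x.1 0) := by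
    rw [← Complex.ofReal_pow, Real.sq_sqrt h0.le]; push_cast; ring
  have hne : (2 * (1 + x.1 0) : ℂ) ≠ 0 := by exact_mod_cast h0.ne'
  have h1 : (x.1 0 : ℂ) ^ 2 - x.1 1 ^ 2 - x.1 2 ^ 2 - x.1 3 ^ 2 = 1 := by
    exact_mod_cast x.2.2
  have key : (1 + pauli x.1) * (1 + pauli x.1) = (2 * (1 + x.1 0) : ℂ) • pauli x.1 := by
    ext i j
    fin_cases i <;> fin_cases j <;>
      simp [pauli, Matrix.mul_apply, Fin.sum_univ_two]
    · linear_combination (-1 : ℂ) * h1 - (x.1 2 : ℂ) ^ 2 * Complex.I_sq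
    · ring
    · ring
    · linear_combination (-1 : ℂ) * h1 - (x.1 2 : ℂ) ^ 2 * Complex.I_sq
  change (_ • _) * (_ • _) = _
  rw [Matrix.smul_mul, Matrix.mul_smul, smul_smul, key, smul_smul, ← mul_inv, ← pow_two, hs,
    inv_mul_cancel₀ hne, one_smul]

/-- The action of `SL(2,ℂ)` on `ℍ³` by Lorentz transformations,
`pauli (g x) = g (pauli x) g†`. -/
noncomputable def lorentz (g : SL2C) (x : Hyperboloid) : Hyperboloid :=
  ⟨unpauli (g.1 * pauli x.1 * g.1.conjTranspose), by
    have hX : (pauli x.1).conjTranspose = pauli x.1 := by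
      rw [← boost_mul_boost, Matrix.conjTranspose_mul, boost_conjTranspose]
    set Y := g.1 * pauli x.1 * g.1.conjTranspose with hYdef
    have hY : Y.conjTranspose = Y := by
      simp [hYdef, hX, Matrix.mul_assoc]
    have hdet : Y.det = 1 := by
      simp [hYdef, ← boost_mul_boost, Matrix.det_mul, Matrix.det_conjTranspose]
    have hp := pauli_unpauli hY
    constructor
    · have hB : Y = (g * boost x).1 * (g * boost x).1.conjTranspose := by
        rw [hYdef, Matrix.SpecialLinearGroup.coe_mul, Matrix.conjTranspose_mul,
          boost_conjTranspose, ← boost_mul_boost]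
        simp only [Matrix.mul_assoc]
      have hd := (g * boost x).2
      generalize (g * boost x).1 = B at hB hd
      have e0 : (Y 0 0).re = Complex.normSq (B 0 0) + Complex.normSq (B 0 1) := by
        rw [hB]; simp [Matrix.mul_apply, Fin.sum_univ_two, Complex.normSq_apply]
      have e1 : (Y 1 1).re = Complex.normSq (B 1 0) + Complex.normSq (B 1 1) := by
        rw [hB]; simp [Matrix.mul_apply, Fin.sum_univ_two, Complex.normSq_apply]
      have hpos : 0 < Complex.normSq (B 0 0) + Complex.normSq (B 0 1) := by
        by_contra hcon
        have n0 := Complex.normSq_nonneg (B 0 0)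
        have n1 := Complex.normSq_nonneg (B 0 1)
        have z0 : B 0 0 = 0 := Complex.normSq_eq_zero.1 (by linarith)
        have z1 : B 0 1 = 0 := Complex.normSq_eq_zero.1 (by linarith)
        rw [Matrix.det_fin_two, z0, z1] at hd
        simp at hd
      have n2 := Complex.normSq_nonneg (B 1 0)
      have n3 := Complex.normSq_nonneg (B 1 1)
      change 0 < ((Y 0 0).re + (Y 1 1).re) / 2
      rw [e0, e1]
      linarith
    · rw [← hp, Matrix.det_fin_two] at hdet
      generalize unpauli Y = y at hdet
      simp only [pauli] at hdet
      simp at hdet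
      have : ((y 0 ^ 2 - y 1 ^ 2 - y 2 ^ 2 - y 3 ^ 2 : ℝ) : ℂ) = 1 := by
        push_cast
        linear_combination hdet - (y 2 : ℂ) ^ 2 * Complex.I_sq
      exact_mod_cast this⟩

theorem lorentz_boost (x : Hyperboloid) :
    lorentz (boost x) ⟨![1, 0, 0, 0], by simp⟩ = x := by
  have h1 : pauli ![1, 0, 0, 0] = 1 := by
    ext i j
    fin_cases i <;> fin_cases j <;> simp [pauli]
  apply Subtype.ext
  simp only [lorentz]
  rw [h1, Matrix.mul_one, boost_conjTranspose, boost_mul_boost, unpauli_pauli]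

/-- The canonical embedding of `SU(2)` into `SL(2,ℂ)`. -/
def embed (h : SU2) : SL2C := ⟨h.1, (Matrix.mem_specialUnitaryGroup_iff.1 h.2).2⟩

/-- The embedding `h ↦ h_x = Λ_x h Λ_x⁻¹` of `SU(2)` into `SL(2,ℂ)`. -/
noncomputable def embedAt (x : Hyperboloid) (h : SU2) : SL2C := boost x * embed h * (boost x)⁻¹

/-! ### Two-complexes -/

/-- A combinatorial two-complex with boundary graph. `V`: bulk vertices; `N`: nodes of the boundary
graph; `E`: internal edges; `L`: links of the boundary graph; `F`: faces. The endpoints of an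
internal edge are bulk vertices or nodes. The boundary of a face is a nonempty closed walk of
oriented internal edges and links; the Boolean is `true` where the walk runs along the orientation
of the edge (the sign `ε = 1`) and `false` where it runs against it (`ε = -1`). -/
structure TwoComplex (V N E L F : Type*) where
  /-- source of an internal edge -/
  src : E → V ⊕ N
  /-- target of an internal edge -/
  tgt : E → V ⊕ N
  /-- source of a link -/
  linkSrc : L → N
  /-- target of a link -/
  linkTgt : L → N
  /-- number of edges and links in the boundary of a face -/
  len : F → ℕ
  len_pos : ∀ f, 0 < len f
  /-- the oriented edges and links in the boundary of a face, in cyclic order -/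
  bd : (f : F) → Fin (len f) → (E ⊕ L) × Bool
  closed_walk : ∀ f i,
    (match bd f i with
      | (Sum.inl e, true) => tgt e
      | (Sum.inl e, false) => src e
      | (Sum.inr l, true) => Sum.inr (linkTgt l)
      | (Sum.inr l, false) => Sum.inr (linkSrc l)) =
    (match bd f (finRotate _ i) with
      | (Sum.inl e, true) => src e
      | (Sum.inl e, false) => tgt e
      | (Sum.inr l, true) => Sum.inr (linkSrc l)
      | (Sum.inr l, false) => Sum.inr (linkTgt l))
  /-- every internal edge has an endpoint in the bulk -/
  bulk_endpoint : ∀ e, (∃ v, src e = Sum.inl v) ∨ ∃ v, tgt e = Sum.inl v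
  /-- every node bounds exactly one internal edge -/
  node_edge : ∀ n, ∃! e, src e = Sum.inr n ∨ tgt e = Sum.inr n
  /-- every link bounds exactly one face -/
  link_face : ∀ l, ∃! q : (f : F) × Fin (len f), (bd q.1 q.2).1 = Sum.inr l

namespace TwoComplex

variable {V N E L F : Type*} (C : TwoComplex V N E L F)

/-- The endpoint of a half-edge: `(e, true)` is the half of `e` at its source, `(e, false)` the one
at its target. -/
def endpoint (a : E × Bool) : V ⊕ N := if a.2 then C.src a.1 else C.tgt a.1

/-- The half-edges at bulk vertices that carry an integration: one half-edge `root v` is left out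
at every bulk vertex `v`. -/
def FreeHalf (root : V → E × Bool) : Type _ :=
  {a : E × Bool // ∃ v, C.endpoint a = Sum.inl v ∧ root v ≠ a}

/-- The occurrences of internal edges in the boundaries of faces; they label the variables
`h_{ef}`. -/
def Corner : Type _ := {q : (f : F) × Fin (C.len f) // ∃ e, (C.bd q.1 q.2).1 = Sum.inl e}

noncomputable instance [Finite E] (root : V → E × Bool) : Fintype (C.FreeHalf root) :=
  have : Finite (C.FreeHalf root) := Subtype.finite
  Fintype.ofFinite _

noncomputable instance [Finite F] : Fintype C.Corner :=
  have : Finite C.Corner := Subtype.finite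
  Fintype.ofFinite _

open Classical in
/-- The group element at a half-edge: the integration variable if there is one, and `1` at the
half-edge left out at each bulk vertex and at the boundary nodes. -/
noncomputable def halfElt (root : V → E × Bool) (G : C.FreeHalf root → SL2C) (a : E × Bool) :
    SL2C :=
  if ha : ∃ v, C.endpoint a = Sum.inl v ∧ root v ≠ a then G ⟨a, ha⟩ else 1

/-- The frame vectors of all internal edges, given frame vectors `x` of the nodes and frame vectors
`y` of the bulk edges: an edge bounding a node `n` has the frame vector `x n`, an edge between two
bulk vertices has the frame vector `y e`. -/
def edgeFrame (x : N → Hyperboloid) (y : E → Hyperboloid) (e : E) : Hyperboloid :=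
  match C.src e, C.tgt e with
  | Sum.inr n, _ => x n
  | Sum.inl _, Sum.inr n => x n
  | Sum.inl _, Sum.inl _ => y e

/-- The factor `g_{ef}^{ε_{ef}}` at position `i` of the boundary of the face `f`, with
`g_{ef} = g_{e,s(e)} (h_{ef})_{x_e} g_{e,t(e)}⁻¹` for internal edges and `g_{ef} = g_l` for
links. -/
noncomputable def edgeElt (root : V → E × Bool) (x : E → Hyperboloid) (g : L → SL2C)
    (G : C.FreeHalf root → SL2C) (h : C.Corner → SU2) (f : F) (i : Fin (C.len f)) : SL2C :=
  let k : SL2C :=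
    match hb : (C.bd f i).1 with
    | Sum.inl e => C.halfElt root G (e, true) * embedAt (x e) (h ⟨⟨f, i⟩, e, hb⟩)
        * (C.halfElt root G (e, false))⁻¹
    | Sum.inr l => g l
  if (C.bd f i).2 then k else k⁻¹

/-- The ordered product `∏_{e ∈ ∂f} g_{ef}^{ε_{ef}}`. -/
noncomputable def faceElt (root : V → E × Bool) (x : E → Hyperboloid) (g : L → SL2C)
    (G : C.FreeHalf root → SL2C) (h : C.Corner → SU2) (f : F) : SL2C :=
  (List.ofFn (C.edgeElt root x g G h f)).prod

variable [Fintype F]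

/-- The integrand
`∏_f χ^{γ j_f, j_f}(∏_{e ∈ ∂f} g_{ef}^{ε_{ef}}) ∏_{e ∈ ∂f} χ^{j_f}(h_{ef})` for the spins
`j_f = J f / 2`. -/
noncomputable def integrand (γ : ℝ) (root : V → E × Bool) (x : E → Hyperboloid) (J : F → ℕ)
    (g : L → SL2C) (G : C.FreeHalf root → SL2C) (h : C.Corner → SU2) : ℂ :=
  (∏ f, charSL2C (γ * (J f / 2)) (J f) (C.faceElt root x g G h f))
    * ∏ q : C.Corner, charSU2 (J q.1.1) (h q)

/-- The result of the `SU(2)` integrations. -/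
noncomputable def innerIntegral (γ : ℝ) (root : V → E × Bool) (x : E → Hyperboloid) (J : F → ℕ)
    (g : L → SL2C) (G : C.FreeHalf root → SL2C) : ℂ :=
  ∫ h, C.integrand γ root x J g G h ∂(Measure.pi fun _ => haarSU2)

variable [Fintype E]

/-- The contribution `∏_f d_{j_f} ∫ dg_{ev} ∫ dh_{ef} ∏_f …` of the spins `j_f = J f / 2` to the
amplitude, where `d_j = 2j + 1`. -/
noncomputable def spinAmplitude (γ : ℝ) (μ : Measure SL2C) (root : V → E × Bool)
    (x : E → Hyperboloid) (J : F → ℕ) (g : L → SL2C) : ℂ :=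
  (∏ f, ((J f : ℂ) + 1))
    * ∫ G, C.innerIntegral γ root x J g G ∂(Measure.pi fun _ => μ)

/-- The integrals in `spinAmplitude` converge absolutely. -/
def SpinConverges (γ : ℝ) (μ : Measure SL2C) (root : V → E × Bool)
    (x : E → Hyperboloid) (J : F → ℕ) (g : L → SL2C) : Prop :=
  (∀ᵐ G ∂(Measure.pi fun _ : C.FreeHalf root => μ),
    Integrable (fun h => C.integrand γ root x J g G h) (Measure.pi fun _ => haarSU2)) ∧
  Integrable (C.innerIntegral γ root x J g) (Measure.pi fun _ => μ)

/-- The transition amplitude: the sum over all spins `j_f ∈ ℕ/2` of the faces. -/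
noncomputable def amplitude (γ : ℝ) (μ : Measure SL2C) (root : V → E × Bool)
    (x : E → Hyperboloid) (g : L → SL2C) : ℂ :=
  ∑' J : F → ℕ, C.spinAmplitude γ μ root x J g

/-- All integrals and the sum in `amplitude` converge absolutely. -/
def Converges (γ : ℝ) (μ : Measure SL2C) (root : V → E × Bool)
    (x : E → Hyperboloid) (g : L → SL2C) : Prop :=
  (∀ J : F → ℕ, C.SpinConverges γ μ root x J g) ∧
  Summable fun J : F → ℕ => C.spinAmplitude γ μ root x J g

end TwoComplex

end Spinfoam

namespace Spinfoam

/-! ### Invariance of the Haar measures -/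

/-! The theorem is a gauge transformation of the integration variables. Since `Λ Λ_x` and `Λ_{Λx}`
both send the rest vector to `Λx`, they differ by a rotation `u ∈ SU(2)` (`exists_boost_lorentz`),
so `h_{Λx} = Λ (u h u⁻¹)_x Λ⁻¹`. Hence each internal edge has an `A_e ∈ SL(2,ℂ)` carrying its old
embedding of `SU(2)` to the new one up to a rotation: `A_e = Λ_n` for an edge at a node `n`, and a
quotient of boosts for an edge between bulk vertices (`exists_edgeFrame_change`). Substitute `h_{ef}
↦ u_e h_{ef} u_e⁻¹` and `g_{ev} ↦ K_v⁻¹ g_{ev} A_e`, with `K_n = Λ_n` at nodes and `K_v = A_e` for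
the edge `e` whose variable at `v` is fixed to `1`, so that the gauge fixing survives. Every factor
of a face product becomes `K_start * (factor) * K_end⁻¹` (`edgeElt_eq`), links giving exactly `Λ_s⁻¹
g_l Λ_t`. Around the closed walk the `K`'s telescope to a conjugation, which characters do not see.
Both groups are unimodular, so the substitution preserves the measures; integrals and their
convergence agree spin by spin. -/

/-- The modular character takes values in an abelian group, so it kills commutators, and `SL(2,ℂ)`
is perfect. -/
instance isMulRightInvariant_of_isHaarMeasure_SL2C (μ : Measure SL2C) [μ.IsHaarMeasure] :
    μ.IsMulRightInvariant where
  map_mul_right_eq_self g := by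
    have hone : Measure.modularCharacter g = 1 := by
      have hker : commutator SL2C ≤
          (Units.map (Measure.modularCharacter (G := SL2C)) |>.comp
            (toUnits (G := SL2C)).toMonoidHom).ker := Abelianization.commutator_subset_ker _
      have htop : commutator SL2C = ⊤ :=
        Matrix.SL2.commutator_eq_top (a := (2 : ℂ)) (by norm_num) (by norm_num)
      have hg := hker (htop ▸ Subgroup.mem_top g)
      simpa using congrArg Units.val (MonoidHom.mem_ker.1 hg)
    rw [Measure.isMulLeftInvariant_eq_smul (μ.map (· * g)) μ,
      ← Measure.modularCharacterFun_eq_haarScalarFactor μ g]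
    change Measure.modularCharacter g • μ = μ
    rw [hone, one_smul]

instance isHaarMeasure_haarSU2 : haarSU2.IsHaarMeasure :=
  inferInstanceAs (Measure.haarMeasure ⊤).IsHaarMeasure

instance isProbabilityMeasure_haarSU2 : IsProbabilityMeasure haarSU2 :=
  ⟨Measure.haarMeasure_self⟩

/-- A right translate is again left invariant, hence a multiple of the measure; comparing total
masses makes the factor `1`. -/
instance isMulRightInvariant_haarSU2 : haarSU2.IsMulRightInvariant where
  map_mul_right_eq_self g := by
    have h := Measure.isMulLeftInvariant_eq_smul (haarSU2.map (· * g)) haarSU2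
    have hu := congrArg (fun m : Measure SU2 => m Set.univ) h
    simp only [Measure.map_apply (measurable_mul_const g) MeasurableSet.univ, Set.preimage_univ,
      measure_univ, Measure.smul_apply] at hu
    have hc : Measure.haarScalarFactor (haarSU2.map (· * g)) haarSU2 = 1 := by
      simpa [ENNReal.smul_def] using hu.symm
    rwa [hc, one_smul] at h

/-! ### Characters are class functions -/

/-- `charSL2C` sees `g` only through its trace, so neither the branch of the square root nor the
value on the null set matters. -/
theorem charSL2C_conj (p : ℝ) (n : ℕ) (a g : SL2C) :
    charSL2C p n (a * g * a⁻¹) = charSL2C p n g := by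
  have h : Matrix.trace (a * g * a⁻¹).1 = Matrix.trace g.1 := by
    rw [Matrix.SpecialLinearGroup.coe_mul, Matrix.trace_mul_comm]
    change Matrix.trace (a⁻¹ * (a * g)).1 = _
    rw [inv_mul_cancel_left]
  simp only [charSL2C, h]

theorem charSU2_conj (n : ℕ) (u h : SU2) : charSU2 n (u * h * u⁻¹) = charSU2 n h := by
  have ht : Matrix.trace (u * h * u⁻¹).1 = Matrix.trace h.1 := by
    change Matrix.trace ((u * h).1 * (u⁻¹).1) = _
    rw [Matrix.trace_mul_comm]
    change Matrix.trace (u⁻¹ * (u * h)).1 = _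
    rw [inv_mul_cancel_left]
  simp only [charSU2, ht]

/-! ### Lorentz transformations of frames -/

theorem embed_mul (u h : SU2) : embed (u * h) = embed u * embed h := rfl

theorem embed_inv (u : SU2) : embed u⁻¹ = (embed u)⁻¹ := by
  rw [eq_inv_iff_mul_eq_one, ← embed_mul, inv_mul_cancel]
  rfl

/-- With `A = Λ Λ_x`, both `B = A` and `B = Λ_{Λx}` satisfy `B B† = pauli (Λx)`, so `A⁻¹ Λ_{Λx}` is
unitary: the Wigner rotation. -/
theorem exists_boost_lorentz (Λ : SL2C) (x : Hyperboloid) :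
    ∃ u : SU2, boost (lorentz Λ x) = Λ * boost x * embed u := by
  set A : SL2C := Λ * boost x with hA
  set U : SL2C := A⁻¹ * boost (lorentz Λ x) with hU
  have hXH : (Λ.1 * pauli x.1 * Λ.1.conjTranspose).conjTranspose =
      Λ.1 * pauli x.1 * Λ.1.conjTranspose := by
    rw [← boost_mul_boost]
    simp [boost_conjTranspose, Matrix.mul_assoc]
  have hb : (boost (lorentz Λ x)).1 * (boost (lorentz Λ x)).1.conjTranspose =
      A.1 * A.1.conjTranspose := by
    rw [boost_conjTranspose, boost_mul_boost]
    change pauli (unpauli _) = _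
    rw [pauli_unpauli hXH, hA, Matrix.SpecialLinearGroup.coe_mul, Matrix.conjTranspose_mul,
      boost_conjTranspose, ← boost_mul_boost]
    simp only [Matrix.mul_assoc]
  have hinv : (A⁻¹).1 * A.1 = 1 := by
    rw [← Matrix.SpecialLinearGroup.coe_mul, inv_mul_cancel, Matrix.SpecialLinearGroup.coe_one]
  have hUU : U.1 * star U.1 = 1 := by
    rw [Matrix.star_eq_conjTranspose, hU, Matrix.SpecialLinearGroup.coe_mul,
      Matrix.conjTranspose_mul]
    calc _ = (A⁻¹).1 * ((boost (lorentz Λ x)).1 * (boost (lorentz Λ x)).1.conjTranspose) *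
          (A⁻¹).1.conjTranspose := by simp only [Matrix.mul_assoc]
      _ = ((A⁻¹).1 * A.1) * ((A⁻¹).1 * A.1).conjTranspose := by
        rw [hb, Matrix.conjTranspose_mul]; simp only [Matrix.mul_assoc]
      _ = 1 := by rw [hinv]; simp
  refine ⟨⟨U.1, Matrix.mem_specialUnitaryGroup_iff.2 ⟨Matrix.mem_unitaryGroup_iff.2 hUU, U.2⟩⟩, ?_⟩
  change _ = A * U
  rw [hU, mul_inv_cancel_left]

theorem exists_embedAt_lorentz (Λ : SL2C) (x : Hyperboloid) :
    ∃ u : SU2, ∀ h, embedAt (lorentz Λ x) h = Λ * embedAt x (u * h * u⁻¹) * Λ⁻¹ := by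
  obtain ⟨u, hu⟩ := exists_boost_lorentz Λ x
  refine ⟨u, fun h => ?_⟩
  simp only [embedAt, hu, embed_mul, embed_inv]
  group

theorem embedAt_eq_conj (x x' : Hyperboloid) (h : SU2) :
    embedAt x' h = (boost x' * (boost x)⁻¹) * embedAt x h * (boost x' * (boost x)⁻¹)⁻¹ := by
  simp only [embedAt]
  group

/-! ### Telescoping products -/

theorem prod_ofFn_telescope {G : Type*} [Group G] (c : ℕ → G) {n : ℕ} (k : Fin n → G) :
    (List.ofFn fun i : Fin n => c i * k i * (c (i + 1))⁻¹).prod =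
      c 0 * (List.ofFn k).prod * (c n)⁻¹ := by
  induction n generalizing c with
  | zero => simp
  | succ n ih =>
    have h := ih (fun j => c (j + 1)) (fun i => k i.succ)
    simp only [List.ofFn_succ, List.prod_cons, Fin.val_succ, Fin.val_zero] at h ⊢
    rw [h]
    group

/-- Cyclic telescoping: the gauge factor left at the end of the walk is the one at its start. -/
theorem exists_prod_ofFn_eq_conj {G : Type*} [Group G] {n : ℕ} (k k' s t : Fin n → G)
    (hk : ∀ i, k' i = s i * k i * (t i)⁻¹) (ht : ∀ i, t i = s (finRotate n i)) :
    ∃ a : G, (List.ofFn k').prod = a * (List.ofFn k).prod * a⁻¹ := by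
  cases n with
  | zero => exact ⟨1, by simp⟩
  | succ m =>
    -- Extending `s` periodically to `ℕ` makes the factors at `0` and at `m + 1` coincide.
    have h := prod_ofFn_telescope (fun j => s (Fin.ofNat (m + 1) j)) k
    refine ⟨s 0, ?_⟩
    have hs (i : Fin (m + 1)) : Fin.ofNat (m + 1) (i + 1) = i + 1 := by
      ext; simp [Fin.val_add]
    have hl : Fin.ofNat (m + 1) (m + 1) = 0 := by ext; simp
    have h0 : Fin.ofNat (m + 1) 0 = 0 := rfl
    simp only [hs, hl, h0, Fin.ofNat_val_eq_self] at h
    rw [← h]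
    congr 2
    funext i
    rw [hk, ht, finRotate_apply]

/-! ### Change of variables -/

namespace TwoComplex

variable {V N E L F : Type*} (C : TwoComplex V N E L F)

/-- The initial point of an oriented edge or link. -/
def walkStart : (E ⊕ L) × Bool → V ⊕ N
  | (Sum.inl e, true) => C.src e
  | (Sum.inl e, false) => C.tgt e
  | (Sum.inr l, true) => Sum.inr (C.linkSrc l)
  | (Sum.inr l, false) => Sum.inr (C.linkTgt l)

/-- The final point of an oriented edge or link. -/
def walkEnd : (E ⊕ L) × Bool → V ⊕ N
  | (Sum.inl e, true) => C.tgt e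
  | (Sum.inl e, false) => C.src e
  | (Sum.inr l, true) => Sum.inr (C.linkTgt l)
  | (Sum.inr l, false) => Sum.inr (C.linkSrc l)

theorem walkEnd_bd (f : F) (i : Fin (C.len f)) :
    C.walkEnd (C.bd f i) = C.walkStart (C.bd f (finRotate _ i)) :=
  C.closed_walk f i

/-- The internal edge at a corner. -/
noncomputable def cornerEdge (q : C.Corner) : E := q.2.choose

theorem cornerEdge_eq {f : F} {i : Fin (C.len f)} {e : E} (hb : (C.bd f i).1 = Sum.inl e) :
    C.cornerEdge ⟨⟨f, i⟩, e, hb⟩ = e :=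
  Sum.inl_injective ((Exists.choose_spec (⟨e, hb⟩ : ∃ e, (C.bd f i).1 = Sum.inl e)).symm.trans hb)

/-- The change of the `SL(2,ℂ)` variables `g_{ev} ↦ K_v⁻¹ g_{ev} A_e`. -/
noncomputable def halfEquiv (root : V → E × Bool) (A : E → SL2C) (K : V ⊕ N → SL2C) :
    (C.FreeHalf root → SL2C) ≃ᵐ (C.FreeHalf root → SL2C) :=
  MeasurableEquiv.piCongrRight fun a =>
    (MeasurableEquiv.mulLeft (K (C.endpoint a.1))⁻¹).trans (MeasurableEquiv.mulRight (A a.1.1))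

/-- The change of the `SU(2)` variables `h_{ef} ↦ u_e h_{ef} u_e⁻¹`. -/
noncomputable def cornerEquiv (u : E → SU2) : (C.Corner → SU2) ≃ᵐ (C.Corner → SU2) :=
  MeasurableEquiv.piCongrRight fun q =>
    (MeasurableEquiv.mulLeft (u (C.cornerEdge q))).trans
      (MeasurableEquiv.mulRight (u (C.cornerEdge q))⁻¹)

theorem halfEquiv_apply (root : V → E × Bool) (A : E → SL2C) (K : V ⊕ N → SL2C)
    (G : C.FreeHalf root → SL2C) (a : E × Bool)
    (ha : ∃ v, C.endpoint a = Sum.inl v ∧ root v ≠ a) :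
    C.halfEquiv root A K G ⟨a, ha⟩ = (K (C.endpoint a))⁻¹ * G ⟨a, ha⟩ * A a.1 := rfl

theorem cornerEquiv_apply (u : E → SU2) (h : C.Corner → SU2) (q : C.Corner) :
    C.cornerEquiv u h q = u (C.cornerEdge q) * h q * (u (C.cornerEdge q))⁻¹ := rfl

theorem measurePreserving_halfEquiv [Fintype E] (μ : Measure SL2C) [μ.IsHaarMeasure]
    (root : V → E × Bool) (A : E → SL2C) (K : V ⊕ N → SL2C) :
    MeasurePreserving (C.halfEquiv root A K) (Measure.pi fun _ => μ) (Measure.pi fun _ => μ) :=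
  measurePreserving_pi (fun _ => μ) (fun _ => μ)
    (f := fun a : C.FreeHalf root => (· * A a.1.1) ∘ ((K (C.endpoint a.1))⁻¹ * ·)) fun a =>
    (measurePreserving_mul_right μ (A a.1.1)).comp
      (measurePreserving_mul_left μ (K (C.endpoint a.1))⁻¹)

theorem measurePreserving_cornerEquiv [Fintype F] (u : E → SU2) :
    MeasurePreserving (C.cornerEquiv u) (Measure.pi fun _ => haarSU2)
      (Measure.pi fun _ => haarSU2) :=
  measurePreserving_pi (fun _ => haarSU2) (fun _ => haarSU2)
    (f := fun q : C.Corner => (· * (u (C.cornerEdge q))⁻¹) ∘ (u (C.cornerEdge q) * ·)) fun q =>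
    (measurePreserving_mul_right haarSU2 (u (C.cornerEdge q))⁻¹).comp
      (measurePreserving_mul_left haarSU2 (u (C.cornerEdge q)))

/-! ### Gauge covariance of the integrand and the integrals -/

section Gauge

variable {C} {root : V → E × Bool} {x x' : E → Hyperboloid} {A : E → SL2C} {u : E → SU2}
  {K : V ⊕ N → SL2C} {g g' : L → SL2C}

/-- At half-edges without a variable the group element is `1` before and after the substitution;
`hK` is exactly the compatibility this requires. -/
theorem halfElt_mul
    (hK : ∀ a, (¬∃ v, C.endpoint a = Sum.inl v ∧ root v ≠ a) → K (C.endpoint a) = A a.1)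
    (G : C.FreeHalf root → SL2C) (a : E × Bool) :
    C.halfElt root G a * A a.1 = K (C.endpoint a) * C.halfElt root (C.halfEquiv root A K G) a := by
  by_cases ha : ∃ v, C.endpoint a = Sum.inl v ∧ root v ≠ a
  · simp only [halfElt, dif_pos ha, halfEquiv_apply]
    group
  · simp only [halfElt, dif_neg ha, hK a ha, one_mul, mul_one]

theorem edgeElt_eq
    (hA : ∀ e h, embedAt (x' e) h = A e * embedAt (x e) (u e * h * (u e)⁻¹) * (A e)⁻¹)
    (hK : ∀ a, (¬∃ v, C.endpoint a = Sum.inl v ∧ root v ≠ a) → K (C.endpoint a) = A a.1)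
    (hg : ∀ l, g l = K (Sum.inr (C.linkSrc l)) * g' l * (K (Sum.inr (C.linkTgt l)))⁻¹)
    (G : C.FreeHalf root → SL2C) (h : C.Corner → SU2) (f : F) (i : Fin (C.len f)) :
    C.edgeElt root x' g G h f i = K (C.walkStart (C.bd f i)) *
      C.edgeElt root x g' (C.halfEquiv root A K G) (C.cornerEquiv u h) f i *
        (K (C.walkEnd (C.bd f i)))⁻¹ := by
  have key (e : E) (k : SU2) :
      C.halfElt root G (e, true) * embedAt (x' e) k * (C.halfElt root G (e, false))⁻¹ =
      K (C.src e) * (C.halfElt root (C.halfEquiv root A K G) (e, true) *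
        embedAt (x e) (u e * k * (u e)⁻¹) *
        (C.halfElt root (C.halfEquiv root A K G) (e, false))⁻¹) * (K (C.tgt e))⁻¹ := by
    have hs := halfElt_mul hK G (e, true)
    have ht := halfElt_mul hK G (e, false)
    simp only [endpoint, if_true, Bool.false_eq_true, if_false] at hs ht
    -- Solved for the old half-edge elements, both ends carry a factor of `A e` that cancels against
    -- the conjugation in `hA`.
    rw [← eq_mul_inv_iff_mul_eq] at hs ht
    rw [hA, hs, ht]
    group
  rcases hbd : C.bd f i with ⟨e | l, b⟩
  · have hb : (C.bd f i).1 = Sum.inl e := by rw [hbd]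
    have hb2 : (C.bd f i).2 = b := by rw [hbd]
    -- Stated for arbitrary data, so that the dependent match in `edgeElt` is resolved once for both
    -- sides.
    have hval (x : E → Hyperboloid) (g : L → SL2C) (G : C.FreeHalf root → SL2C)
        (h : C.Corner → SU2) : C.edgeElt root x g G h f i =
        let k := C.halfElt root G (e, true) * embedAt (x e) (h ⟨⟨f, i⟩, e, hb⟩)
          * (C.halfElt root G (e, false))⁻¹
        if b then k else k⁻¹ := by
      unfold edgeElt
      rw [hb2]
      split
      · next e' he' =>
        obtain rfl : e' = e := Sum.inl_injective (he'.symm.trans hb)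
        rfl
      · next l' hl' => exact absurd (hl'.symm.trans hb) (by simp)
    have hq : C.cornerEquiv u h ⟨⟨f, i⟩, e, hb⟩ = u e * h ⟨⟨f, i⟩, e, hb⟩ * (u e)⁻¹ := by
      rw [← congrArg u (C.cornerEdge_eq hb)]
      rfl
    rw [hval, hval, hq, key]
    cases b
    · simp only [walkStart, walkEnd, Bool.false_eq_true, if_false]
      group
    · simp only [walkStart, walkEnd, if_true]
  · have hb : (C.bd f i).1 = Sum.inr l := by rw [hbd]
    have hb2 : (C.bd f i).2 = b := by rw [hbd]
    have hval (x : E → Hyperboloid) (g : L → SL2C) (G : C.FreeHalf root → SL2C)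
        (h : C.Corner → SU2) : C.edgeElt root x g G h f i = if b then g l else (g l)⁻¹ := by
      unfold edgeElt
      rw [hb2]
      split
      · next e' he' => exact absurd (he'.symm.trans hb) (by simp)
      · next l' hl' =>
        obtain rfl : l' = l := Sum.inr_injective (hl'.symm.trans hb)
        rfl
    rw [hval, hval, hg]
    cases b
    · simp only [walkStart, walkEnd, Bool.false_eq_true, if_false]
      group
    · simp only [walkStart, walkEnd, if_true]

theorem integrand_eq [Fintype F] (γ : ℝ) (J : F → ℕ)
    (hA : ∀ e h, embedAt (x' e) h = A e * embedAt (x e) (u e * h * (u e)⁻¹) * (A e)⁻¹)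
    (hK : ∀ a, (¬∃ v, C.endpoint a = Sum.inl v ∧ root v ≠ a) → K (C.endpoint a) = A a.1)
    (hg : ∀ l, g l = K (Sum.inr (C.linkSrc l)) * g' l * (K (Sum.inr (C.linkTgt l)))⁻¹)
    (G : C.FreeHalf root → SL2C) (h : C.Corner → SU2) :
    C.integrand γ root x' J g G h =
      C.integrand γ root x J g' (C.halfEquiv root A K G) (C.cornerEquiv u h) := by
  have hface (f : F) : charSL2C (γ * (J f / 2)) (J f) (C.faceElt root x' g G h f) =
      charSL2C (γ * (J f / 2)) (J f)
        (C.faceElt root x g' (C.halfEquiv root A K G) (C.cornerEquiv u h) f) := by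
    obtain ⟨a, ha⟩ := exists_prod_ofFn_eq_conj
      (C.edgeElt root x g' (C.halfEquiv root A K G) (C.cornerEquiv u h) f)
      (C.edgeElt root x' g G h f) (fun i => K (C.walkStart (C.bd f i)))
      (fun i => K (C.walkEnd (C.bd f i))) (edgeElt_eq hA hK hg G h f)
      fun i => by rw [walkEnd_bd]
    rw [faceElt, ha, charSL2C_conj, faceElt]
  have hcorner (q : C.Corner) :
      charSU2 (J q.1.1) (h q) = charSU2 (J q.1.1) (C.cornerEquiv u h q) := by
    rw [cornerEquiv_apply, charSU2_conj]
  exact congrArg₂ (· * ·) (Finset.prod_congr rfl fun f _ => hface f)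
    (Finset.prod_congr rfl fun q _ => hcorner q)

/-- The substitution is a measurable equivalence, so no measurability of the integrand is needed;
the same holds for the integral identities below. -/
theorem integrable_integrand_iff [Fintype F] (γ : ℝ) (J : F → ℕ)
    (hA : ∀ e h, embedAt (x' e) h = A e * embedAt (x e) (u e * h * (u e)⁻¹) * (A e)⁻¹)
    (hK : ∀ a, (¬∃ v, C.endpoint a = Sum.inl v ∧ root v ≠ a) → K (C.endpoint a) = A a.1)
    (hg : ∀ l, g l = K (Sum.inr (C.linkSrc l)) * g' l * (K (Sum.inr (C.linkTgt l)))⁻¹)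
    (G : C.FreeHalf root → SL2C) :
    Integrable (fun h => C.integrand γ root x' J g G h) (Measure.pi fun _ => haarSU2) ↔
      Integrable (fun h => C.integrand γ root x J g' (C.halfEquiv root A K G) h)
        (Measure.pi fun _ => haarSU2) := by
  simp only [integrand_eq γ J hA hK hg]
  exact (C.measurePreserving_cornerEquiv u).integrable_comp_emb
    (C.cornerEquiv u).measurableEmbedding
    (g := C.integrand γ root x J g' (C.halfEquiv root A K G))

theorem innerIntegral_eq [Fintype F] (γ : ℝ) (J : F → ℕ)
    (hA : ∀ e h, embedAt (x' e) h = A e * embedAt (x e) (u e * h * (u e)⁻¹) * (A e)⁻¹)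
    (hK : ∀ a, (¬∃ v, C.endpoint a = Sum.inl v ∧ root v ≠ a) → K (C.endpoint a) = A a.1)
    (hg : ∀ l, g l = K (Sum.inr (C.linkSrc l)) * g' l * (K (Sum.inr (C.linkTgt l)))⁻¹)
    (G : C.FreeHalf root → SL2C) :
    C.innerIntegral γ root x' J g G =
      C.innerIntegral γ root x J g' (C.halfEquiv root A K G) := by
  simp only [innerIntegral, integrand_eq γ J hA hK hg]
  exact (C.measurePreserving_cornerEquiv u).integral_comp (C.cornerEquiv u).measurableEmbedding
    (C.integrand γ root x J g' (C.halfEquiv root A K G))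

theorem spinConverges_iff [Fintype E] [Fintype F] (γ : ℝ) (μ : Measure SL2C) [μ.IsHaarMeasure]
    (J : F → ℕ)
    (hA : ∀ e h, embedAt (x' e) h = A e * embedAt (x e) (u e * h * (u e)⁻¹) * (A e)⁻¹)
    (hK : ∀ a, (¬∃ v, C.endpoint a = Sum.inl v ∧ root v ≠ a) → K (C.endpoint a) = A a.1)
    (hg : ∀ l, g l = K (Sum.inr (C.linkSrc l)) * g' l * (K (Sum.inr (C.linkTgt l)))⁻¹) :
    C.SpinConverges γ μ root x' J g ↔ C.SpinConverges γ μ root x J g' := by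
  have hΦ := C.measurePreserving_halfEquiv μ root A K
  unfold SpinConverges
  refine and_congr ?_ ?_
  · simp only [integrable_integrand_iff γ J hA hK hg]
    -- Writing the measure as its own image under the substitution moves the almost-everywhere
    -- statement to the transformed variables.
    conv_rhs => rw [← hΦ.map_eq]
    exact ((C.halfEquiv root A K).measurableEmbedding.ae_map_iff (μ := Measure.pi fun _ => μ)
      (p := fun G => Integrable (fun h => C.integrand γ root x J g' G h)
        (Measure.pi fun _ => haarSU2))).symm
  · rw [funext (innerIntegral_eq γ J hA hK hg)]
    exact hΦ.integrable_comp_emb (C.halfEquiv root A K).measurableEmbedding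
      (g := C.innerIntegral γ root x J g')

theorem spinAmplitude_eq [Fintype E] [Fintype F] (γ : ℝ) (μ : Measure SL2C) [μ.IsHaarMeasure]
    (J : F → ℕ)
    (hA : ∀ e h, embedAt (x' e) h = A e * embedAt (x e) (u e * h * (u e)⁻¹) * (A e)⁻¹)
    (hK : ∀ a, (¬∃ v, C.endpoint a = Sum.inl v ∧ root v ≠ a) → K (C.endpoint a) = A a.1)
    (hg : ∀ l, g l = K (Sum.inr (C.linkSrc l)) * g' l * (K (Sum.inr (C.linkTgt l)))⁻¹) :
    C.spinAmplitude γ μ root x' J g = C.spinAmplitude γ μ root x J g' := by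
  simp only [spinAmplitude, innerIntegral_eq γ J hA hK hg]
  rw [(C.measurePreserving_halfEquiv μ root A K).integral_comp
    (C.halfEquiv root A K).measurableEmbedding (C.innerIntegral γ root x J g')]

end Gauge

/-- Edges between bulk vertices may change frame arbitrarily because nothing prescribes their `A`;
at a node it must be `Λ n`, since no variable there can absorb a discrepancy. -/
theorem exists_edgeFrame_change (x : N → Hyperboloid) (y y' : E → Hyperboloid) (Λ : N → SL2C)
    (e : E) : ∃ (A : SL2C) (u : SU2),
      (∀ h, embedAt (C.edgeFrame (fun n => lorentz (Λ n) (x n)) y' e) h =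
        A * embedAt (C.edgeFrame x y e) (u * h * u⁻¹) * A⁻¹) ∧
      ∀ n, C.src e = Sum.inr n ∨ C.tgt e = Sum.inr n → A = Λ n := by
  unfold edgeFrame
  rcases hs : C.src e with v | n <;> rcases ht : C.tgt e with w | m
  · refine ⟨boost (y' e) * (boost (y e))⁻¹, 1, fun h => ?_, by simp⟩
    simpa using embedAt_eq_conj (y e) (y' e) h
  · obtain ⟨u, hu⟩ := exists_embedAt_lorentz (Λ m) (x m)
    exact ⟨Λ m, u, hu, by simp⟩
  · obtain ⟨u, hu⟩ := exists_embedAt_lorentz (Λ n) (x n)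
    exact ⟨Λ n, u, hu, by simp⟩
  -- An edge joining two nodes would need both `Λ`'s at once; `bulk_endpoint` excludes it.
  · exfalso
    simpa [hs, ht] using C.bulk_endpoint e

end TwoComplex

end Spinfoam

theorem theorem3 {V N E L F : Type*} [Fintype E] [Fintype F]
    (C : Spinfoam.TwoComplex V N E L F)
    (γ : ℝ) (hγ : 0 < γ)
    (μ : MeasureTheory.Measure Spinfoam.SL2C) [μ.IsHaarMeasure]
    (root : V → E × Bool) (hroot : ∀ v, C.endpoint (root v) = Sum.inl v)
    (x : N → Spinfoam.Hyperboloid) (y y' : E → Spinfoam.Hyperboloid)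
    (Λ : N → Spinfoam.SL2C) (g : L → Spinfoam.SL2C) :
    (∀ J : F → ℕ,
      (C.SpinConverges γ μ root (C.edgeFrame (fun n => Spinfoam.lorentz (Λ n) (x n)) y') J g ↔
        C.SpinConverges γ μ root (C.edgeFrame x y) J
          (fun l => (Λ (C.linkSrc l))⁻¹ * g l * Λ (C.linkTgt l))) ∧
      C.spinAmplitude γ μ root (C.edgeFrame (fun n => Spinfoam.lorentz (Λ n) (x n)) y') J g =
        C.spinAmplitude γ μ root (C.edgeFrame x y) J
          (fun l => (Λ (C.linkSrc l))⁻¹ * g l * Λ (C.linkTgt l))) ∧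
    (C.Converges γ μ root (C.edgeFrame (fun n => Spinfoam.lorentz (Λ n) (x n)) y') g ↔
      C.Converges γ μ root (C.edgeFrame x y)
        (fun l => (Λ (C.linkSrc l))⁻¹ * g l * Λ (C.linkTgt l))) ∧
    C.amplitude γ μ root (C.edgeFrame (fun n => Spinfoam.lorentz (Λ n) (x n)) y') g =
      C.amplitude γ μ root (C.edgeFrame x y)
        (fun l => (Λ (C.linkSrc l))⁻¹ * g l * Λ (C.linkTgt l)) := by
  choose A u hA hΛ using C.exists_edgeFrame_change x y y' Λ
  -- The gauge element is `A` of the root edge at a bulk vertex and `Λ` at a node; a half-edge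
  -- without a variable is either a root or ends at a node.
  have hK (a : E × Bool) (ha : ¬∃ v, C.endpoint a = Sum.inl v ∧ root v ≠ a) :
      Sum.elim (fun v => A (root v).1) Λ (C.endpoint a) = A a.1 := by
    rcases he : C.endpoint a with v | n
    · have hv : root v = a := by
        by_contra hne
        exact ha ⟨v, he, hne⟩
      simp [hv]
    · refine (hΛ a.1 n ?_).symm
      unfold Spinfoam.TwoComplex.endpoint at he
      split_ifs at he
      exacts [Or.inl he, Or.inr he]
  have hg (l : L) : g l = Sum.elim (fun v => A (root v).1) Λ (Sum.inr (C.linkSrc l)) *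
      ((Λ (C.linkSrc l))⁻¹ * g l * Λ (C.linkTgt l)) *
        (Sum.elim (fun v => A (root v).1) Λ (Sum.inr (C.linkTgt l)))⁻¹ := by
    simp only [Sum.elim_inr]
    group
  have hconv (J : F → ℕ) := Spinfoam.TwoComplex.spinConverges_iff γ μ J hA hK hg
  have hamp (J : F → ℕ) := Spinfoam.TwoComplex.spinAmplitude_eq γ μ J hA hK hg
  refine ⟨fun J => ⟨hconv J, hamp J⟩, ?_, ?_⟩
  · simp only [Spinfoam.TwoComplex.Converges, hconv, hamp]
  · simp only [Spinfoam.TwoComplex.amplitude, hamp]
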